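/- Let $X$ be a finite set of cardinality $n$ and let $k$ be a field. Relations on $X$ are subsets of $X\times X$, composed by $RS=\{(x,z)\mid \exists y,\ (x,y)\in R,\ (y,z)\in S\}$; they form a monoid. Let $\mathcal R$ be the $k$-algebra of this monoid. A relation $R$ on $X$ is *inessential* if $R=ST$ for some $S\subseteq X\times Y$, $T\subseteq Y\times X$ and some set $Y$ with $|Y|<|X|$, and *essential* otherwise. The inessential relations span a two-sided ideal $I$ of $\mathcal R$; put $\mathcal E=\mathcal R/I$. For a permutation $\sigma$ of $X$ let $\Delta_\sigma=\{(\sigma(x),x)\mid x\in X\}$. Let $N$ be the $k$-linear span in $\mathcal E$ of all elements $(S-\overline S)\Delta_\sigma$, where $S$ is a reflexive essential relation on $X$, $\overline S$ is its transitive closure, and $\sigma$ is a permutation of $X$; it is a two-sided ideal of $\mathcal E$. The algebra of permuted orders on $X$ is $\mathcal P=\mathcal E/N$. **Theorem.** If the characteristic of $k$ is zero or greater than $n$, then $\mathcal P$ is a semisimple $k$-algebra. -/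

import Mathlib

universe u v

/-- A (binary) relation on `X`; `R x y` stands for `(x, y) ∈ R`. -/
structure BinRel (X : Type u) : Type u where
  /-- The underlying predicate. -/
  rel : X → X → Prop

namespace BinRel

variable {X : Type u}

instance : CoeFun (BinRel X) (fun _ => X → X → Prop) := ⟨rel⟩

@[ext] theorem ext {R S : BinRel X} (h : ∀ x y, R x y ↔ S x y) : R = S := by
  obtain ⟨R⟩ := R
  obtain ⟨S⟩ := S
  exact congrArg mk (funext fun x => funext fun y => propext (h x y))

/-- The monoid of all relations on `X`: `R * S` is the composite
`{(x, z) | ∃ y, (x, y) ∈ R ∧ (y, z) ∈ S}`, and the unit is the diagonal `Δ`. -/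
instance : Monoid (BinRel X) where
  mul R S := ⟨Relation.Comp R.rel S.rel⟩
  one := ⟨fun x y => x = y⟩
  mul_assoc _ _ _ := congrArg mk Relation.comp_assoc
  one_mul _ := congrArg mk Relation.eq_comp
  mul_one _ := congrArg mk Relation.comp_eq

theorem mul_iff (R S : BinRel X) (x z : X) : (R * S) x z ↔ ∃ y, R x y ∧ S y z := Iff.rfl

theorem one_iff (x y : X) : (1 : BinRel X) x y ↔ x = y := Iff.rfl

/-- `R` is inessential if it factorizes as `R = S T` with `S ⊆ X × Y`, `T ⊆ Y × X`, for some
(finite) set `Y` of cardinality strictly smaller than that of the finite set `X`. -/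
def Inessential (R : BinRel X) : Prop :=
  ∃ (Y : Type u) (_ : Finite Y), Nat.card Y < Nat.card X ∧
    ∃ (S : X → Y → Prop) (T : Y → X → Prop), R.rel = Relation.Comp S T

/-- `R` is essential if it is not inessential. -/
def Essential (R : BinRel X) : Prop := ¬ R.Inessential

/-- `R` is reflexive, that is, it contains the diagonal. -/
def IsReflexive (R : BinRel X) : Prop := ∀ x, R x x

/-- The transitive closure of `R`. -/
def closure (R : BinRel X) : BinRel X := ⟨Relation.TransGen R.rel⟩

/-- The relation `Δ_σ = {(σ x, x) | x ∈ X}` attached to a permutation `σ` of `X`. -/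
def ofPerm (σ : Equiv.Perm X) : BinRel X := ⟨fun x y => x = σ y⟩

theorem ofPerm_mul (σ τ : Equiv.Perm X) : ofPerm σ * ofPerm τ = ofPerm (σ * τ) := by
  ext x y
  simp [mul_iff, ofPerm]

theorem ofPerm_one : ofPerm (1 : Equiv.Perm X) = 1 := by
  ext x y
  simp [one_iff, ofPerm]

theorem Inessential.mul_left {R : BinRel X} (h : R.Inessential) (Q : BinRel X) :
    (Q * R).Inessential := by
  obtain ⟨Y, hY, hc, S, T, h⟩ := h
  refine ⟨Y, hY, hc, Relation.Comp Q.rel S, T, ?_⟩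
  rw [Relation.comp_assoc, ← h]
  rfl

theorem Inessential.mul_right {R : BinRel X} (h : R.Inessential) (Q : BinRel X) :
    (R * Q).Inessential := by
  obtain ⟨Y, hY, hc, S, T, h⟩ := h
  refine ⟨Y, hY, hc, S, Relation.Comp T Q.rel, ?_⟩
  rw [← Relation.comp_assoc, ← h]
  rfl

theorem IsReflexive.mul {R S : BinRel X} (hR : R.IsReflexive) (hS : S.IsReflexive) :
    (R * S).IsReflexive := fun x => ⟨x, hR x, hS x⟩

theorem IsReflexive.closure {R : BinRel X} (hR : R.IsReflexive) : R.closure.IsReflexive :=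
  fun x => Relation.TransGen.single (hR x)

theorem closure_le {R S : BinRel X} (h : ∀ x y, R x y → S.closure x y) (x y : X)
    (hxy : R.closure x y) : S.closure x y := by
  induction hxy with
  | single h1 => exact h _ _ h1
  | tail _ h1 ih => exact Relation.TransGen.trans ih (h _ _ h1)

theorem le_closure {R : BinRel X} {x y : X} (h : R x y) : R.closure x y :=
  Relation.TransGen.single h

theorem closure_mul_closure {T S : BinRel X} (hT : T.IsReflexive) (hS : S.IsReflexive) :
    (T * S.closure).closure = (T * S).closure := by
  ext x y
  constructor
  · apply closure_le
    rintro a b ⟨c, hac, hcb⟩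
    refine Relation.TransGen.trans (le_closure (⟨c, hac, hS c⟩ : (T * S) a c)) ?_
    exact closure_le (fun p q hpq => le_closure (⟨p, hT p, hpq⟩ : (T * S) p q)) _ _ hcb
  · apply closure_le
    rintro a b ⟨c, hac, hcb⟩
    exact le_closure (⟨c, hac, le_closure hcb⟩ : (T * S.closure) a b)

theorem closure_closure_mul {T S : BinRel X} (hT : T.IsReflexive) (hS : S.IsReflexive) :
    (S.closure * T).closure = (S * T).closure := by
  ext x y
  constructor
  · apply closure_le
    rintro a b ⟨c, hac, hcb⟩
    refine Relation.TransGen.trans ?_ (le_closure (⟨c, hS c, hcb⟩ : (S * T) c b))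
    exact closure_le (fun p q hpq => le_closure (⟨q, hpq, hT q⟩ : (S * T) p q)) _ _ hac
  · apply closure_le
    rintro a b ⟨c, hac, hcb⟩
    exact le_closure (⟨c, le_closure hac, hcb⟩ : (S.closure * T) a b)

theorem conj_iff (R : BinRel X) (σ : Equiv.Perm X) (x y : X) :
    (ofPerm σ * R * ofPerm σ⁻¹) x y ↔ R (σ⁻¹ x) (σ⁻¹ y) := by
  simp only [mul_iff, ofPerm]
  constructor
  · rintro ⟨b, ⟨a, rfl, h⟩, rfl⟩
    simpa using h
  · intro h
    exact ⟨σ⁻¹ y, ⟨σ⁻¹ x, by simp, h⟩, rfl⟩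

theorem IsReflexive.conj {R : BinRel X} (hR : R.IsReflexive) (σ : Equiv.Perm X) :
    (ofPerm σ * R * ofPerm σ⁻¹).IsReflexive := fun x => (conj_iff R σ x x).2 (hR _)

theorem closure_conj (R : BinRel X) (σ : Equiv.Perm X) :
    (ofPerm σ * R * ofPerm σ⁻¹).closure = ofPerm σ * R.closure * ofPerm σ⁻¹ := by
  ext x y
  rw [conj_iff]
  constructor
  · intro h
    exact Relation.TransGen.lift (fun z => σ⁻¹ z) (fun a b hab => (conj_iff R σ a b).1 hab) _ _ h
  · intro h
    have := Relation.TransGen.lift (p := (ofPerm σ * R * ofPerm σ⁻¹).rel) (fun z => σ z)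
      (fun a b hab => (conj_iff R σ _ _).2 (by simpa using hab)) _ _ h
    simpa [closure, Function.onFun] using this

/-- The transitive closure of an inessential reflexive relation is inessential. -/
theorem Inessential.closure [Finite X] {R : BinRel X} (h : R.Inessential) (hR : R.IsReflexive) :
    R.closure.Inessential := by
  classical
  obtain ⟨Y, hY, hc, S, T, h⟩ := h
  simp only [IsReflexive, h, Relation.Comp] at hR
  choose f hf1 hf2 using hR
  have hinj : ¬ Function.Injective f := fun hi => absurd (Nat.card_le_card_of_injective f hi)
    (not_le.2 hc)
  simp only [Function.Injective, not_forall] at hinj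
  obtain ⟨a, b, hab, hne⟩ := hinj
  have hRi : ∀ {x z} y, S x y → T y z → R.closure x z := fun y h1 h2 =>
    le_closure (by rw [h]; exact ⟨y, h1, h2⟩)
  have h1 : R.closure a b := hRi (f a) (hf1 a) (hab ▸ hf2 b)
  have h2 : R.closure b a := hRi (f a) (hab ▸ hf1 b) (hf2 a)
  have hr : ∀ x, R.closure x x := fun x => hRi (f x) (hf1 x) (hf2 x)
  refine ⟨{x : X // x ≠ b}, inferInstance, ?_, fun x y => R.closure x y,
    fun y z => R.closure y z, ?_⟩
  · exact Finite.card_subtype_lt (x := b) (by simp)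
  · funext x z
    apply propext
    constructor
    · intro hxz
      by_cases hx : x = b
      · subst hx
        exact ⟨⟨a, hne⟩, h2, Relation.TransGen.trans h1 hxz⟩
      · exact ⟨⟨x, hx⟩, hr x, hxz⟩
    · rintro ⟨y, h3, h4⟩
      exact Relation.TransGen.trans h3 h4

/-- An essential relation contains a permutation. -/
theorem Essential.exists_perm [Finite X] {R : BinRel X} (h : R.Essential) :
    ∃ σ : Equiv.Perm X, ∀ x, R (σ x) x := by
  classical
  have := Fintype.ofFinite X
  have key := (Fintype.all_card_le_filter_rel_iff_exists_injective (fun y x : X => R x y)).1 ?_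
  · obtain ⟨f, hf, hf'⟩ := key
    exact ⟨Equiv.ofBijective f (Finite.injective_iff_bijective.1 hf), hf'⟩
  · intro A
    by_contra hA
    push Not at hA
    apply h
    refine ⟨{y : X // y ∉ A} ⊕ {x : X // ∃ a ∈ A, R x a}, inferInstance, ?_,
      fun x s => Sum.elim (fun y : {y : X // y ∉ A} => R x y)
        (fun x' : {x : X // ∃ a ∈ A, R x a} => x = x') s,
      fun s z => Sum.elim (fun y : {y : X // y ∉ A} => (y : X) = z)
        (fun x' : {x : X // ∃ a ∈ A, R x a} => R x' z) s, ?_⟩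
    · rw [Nat.card_eq_fintype_card, Nat.card_eq_fintype_card, Fintype.card_sum,
        Fintype.card_subtype_compl, Fintype.card_coe, Fintype.card_subtype]
      have := Finset.card_le_univ A
      omega
    · funext x z
      apply propext
      constructor
      · intro hxz
        by_cases hz : z ∈ A
        · exact ⟨Sum.inr ⟨x, z, hz, hxz⟩, rfl, hxz⟩
        · exact ⟨Sum.inl ⟨z, hz⟩, hxz, rfl⟩
      · rintro ⟨y | x', h3, h4⟩
        · simp only [Sum.elim_inl] at h3 h4
          exact h4 ▸ h3
        · simp only [Sum.elim_inr] at h3 h4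
          exact h3 ▸ h4

end BinRel

/-- The `k`-algebra of the monoid of all relations on `X`. -/
abbrev RelAlgebra (k : Type v) [CommRing k] (X : Type u) := MonoidAlgebra k (BinRel X)

section EssentialAlgebra

variable (k : Type v) [CommRing k] (X : Type u)

/-- The `k`-linear span of the inessential relations. -/
noncomputable def inessentialSpan : Submodule k (RelAlgebra k X) :=
  Submodule.span k {a | ∃ R : BinRel X, R.Inessential ∧ a = MonoidAlgebra.of k _ R}

theorem relAlgebra_span :
    Submodule.span k (Set.range (MonoidAlgebra.of k (BinRel X))) = ⊤ := by
  rw [eq_top_iff]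
  rintro a -
  induction a using MonoidAlgebra.induction_on with
  | of R => exact Submodule.subset_span ⟨R, rfl⟩
  | add a b ha hb => exact add_mem ha hb
  | smul r a ha => exact Submodule.smul_mem _ r ha

theorem inessentialSpan_mul_left (a : RelAlgebra k X) {x : RelAlgebra k X}
    (hx : x ∈ inessentialSpan k X) : a * x ∈ inessentialSpan k X := by
  have h := Submodule.mul_mem_mul
    (show a ∈ Submodule.span k (Set.range (MonoidAlgebra.of k (BinRel X))) by
      rw [relAlgebra_span]; trivial) hx
  rw [inessentialSpan, Submodule.span_mul_span] at h
  refine Submodule.span_mono ?_ h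
  rintro _ ⟨_, ⟨Q, rfl⟩, _, ⟨R, hR, rfl⟩, rfl⟩
  exact ⟨Q * R, hR.mul_left Q, by simp only [map_mul]⟩

theorem inessentialSpan_mul_right (a : RelAlgebra k X) {x : RelAlgebra k X}
    (hx : x ∈ inessentialSpan k X) : x * a ∈ inessentialSpan k X := by
  have h := Submodule.mul_mem_mul hx
    (show a ∈ Submodule.span k (Set.range (MonoidAlgebra.of k (BinRel X))) by
      rw [relAlgebra_span]; trivial)
  rw [inessentialSpan, Submodule.span_mul_span] at h
  refine Submodule.span_mono ?_ h
  rintro _ ⟨_, ⟨R, hR, rfl⟩, _, ⟨Q, rfl⟩, rfl⟩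
  exact ⟨R * Q, hR.mul_right Q, by simp only [map_mul]⟩

/-- The two-sided ideal `I` of the algebra of relations whose elements are the `k`-linear
combinations of inessential relations. -/
noncomputable def inessentialIdeal : Ideal (RelAlgebra k X) where
  carrier := inessentialSpan k X
  add_mem' := (inessentialSpan k X).add_mem'
  zero_mem' := (inessentialSpan k X).zero_mem'
  smul_mem' a _ hx := inessentialSpan_mul_left k X a hx

instance : (inessentialIdeal k X).IsTwoSided :=
  ⟨fun a hx => inessentialSpan_mul_right k X a hx⟩

/-- The essential algebra `E = R / I`. -/
abbrev EssentialAlgebra := RelAlgebra k X ⧸ inessentialIdeal k X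

/-- The class of a relation in the essential algebra. -/
noncomputable def EssentialAlgebra.of : BinRel X →* EssentialAlgebra k X :=
  (Ideal.Quotient.mk (inessentialIdeal k X) : RelAlgebra k X →* EssentialAlgebra k X).comp
    (MonoidAlgebra.of k (BinRel X))

/-- The `k`-submodule `N` of the essential algebra spanned by the elements `(S - S̄) Δ_σ`, where
`S` is a reflexive essential relation, `S̄` is its transitive closure, and `σ` is a permutation. -/
noncomputable def nilSpan : Submodule k (EssentialAlgebra k X) :=
  Submodule.span k {a | ∃ (S : BinRel X) (σ : Equiv.Perm X), S.IsReflexive ∧ S.Essential ∧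
    a = (EssentialAlgebra.of k X S - EssentialAlgebra.of k X S.closure) *
      EssentialAlgebra.of k X (BinRel.ofPerm σ)}

variable {X}

theorem EssentialAlgebra.of_eq_zero {R : BinRel X} (h : R.Inessential) :
    EssentialAlgebra.of k X R = 0 :=
  Ideal.Quotient.eq_zero_iff_mem.2 (Submodule.subset_span ⟨R, h, rfl⟩)

variable (X) in
theorem essentialAlgebra_span :
    Submodule.span k (Set.range (EssentialAlgebra.of k X)) = ⊤ := by
  have h := congrArg
    (Submodule.map (Ideal.Quotient.mkₐ k (inessentialIdeal k X)).toLinearMap) (relAlgebra_span k X)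
  rw [Submodule.map_span, Submodule.map_top, LinearMap.range_eq_top.2
    (Ideal.Quotient.mkₐ_surjective k (inessentialIdeal k X)), ← Set.range_comp] at h
  exact h

variable [Finite X]

theorem sub_closure_mul_mem {S : BinRel X} (hS : S.IsReflexive) (σ : Equiv.Perm X) :
    (EssentialAlgebra.of k X S - EssentialAlgebra.of k X S.closure) *
      EssentialAlgebra.of k X (BinRel.ofPerm σ) ∈ nilSpan k X := by
  by_cases h : S.Inessential
  · rw [EssentialAlgebra.of_eq_zero k h, EssentialAlgebra.of_eq_zero k (h.closure hS), sub_zero,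
      zero_mul]
    exact zero_mem _
  · exact Submodule.subset_span ⟨S, σ, hS, h, rfl⟩

theorem sub_mul_mem {A B : BinRel X} (hA : A.IsReflexive) (hB : B.IsReflexive)
    (h : A.closure = B.closure) (σ : Equiv.Perm X) :
    (EssentialAlgebra.of k X A - EssentialAlgebra.of k X B) *
      EssentialAlgebra.of k X (BinRel.ofPerm σ) ∈ nilSpan k X := by
  have := sub_mem (sub_closure_mul_mem k hA σ) (sub_closure_mul_mem k hB σ)
  rwa [h, ← sub_mul, sub_sub_sub_cancel_right] at this

variable (X)

theorem nilSpan_mul_left (a : EssentialAlgebra k X) {x : EssentialAlgebra k X}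
    (hx : x ∈ nilSpan k X) : a * x ∈ nilSpan k X := by
  have h := Submodule.mul_mem_mul
    (show a ∈ Submodule.span k (Set.range (EssentialAlgebra.of k X)) by
      rw [essentialAlgebra_span]; trivial) hx
  rw [nilSpan, Submodule.span_mul_span] at h
  refine Submodule.span_le.2 ?_ h
  rintro _ ⟨_, ⟨R, rfl⟩, _, ⟨S, σ, hS, -, rfl⟩, rfl⟩
  show EssentialAlgebra.of k X R * ((EssentialAlgebra.of k X S -
    EssentialAlgebra.of k X S.closure) * EssentialAlgebra.of k X (BinRel.ofPerm σ)) ∈ nilSpan k X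
  by_cases hR : R.Inessential
  · rw [EssentialAlgebra.of_eq_zero k hR, zero_mul]
    exact zero_mem _
  obtain ⟨τ, hτ⟩ := BinRel.Essential.exists_perm hR
  -- write `R = Q * Δ_τ` with `Q` reflexive, and move `Δ_τ` to the right
  set Q : BinRel X := R * BinRel.ofPerm τ⁻¹ with hQ
  have hQr : Q.IsReflexive := fun x => ⟨τ⁻¹ x, by simpa using hτ (τ⁻¹ x), rfl⟩
  have hRQ : R = Q * BinRel.ofPerm τ := by
    rw [hQ, mul_assoc, BinRel.ofPerm_mul, inv_mul_cancel, BinRel.ofPerm_one, mul_one]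
  set S' : BinRel X := BinRel.ofPerm τ * S * BinRel.ofPerm τ⁻¹ with hS'
  have hS'r : S'.IsReflexive := hS.conj τ
  have e : ∀ U : BinRel X, BinRel.ofPerm τ * U =
      (BinRel.ofPerm τ * U * BinRel.ofPerm τ⁻¹) * BinRel.ofPerm τ := by
    intro U
    rw [mul_assoc _ (BinRel.ofPerm τ⁻¹), BinRel.ofPerm_mul, inv_mul_cancel, BinRel.ofPerm_one,
      mul_one]
  have key := sub_mul_mem k (hQr.mul hS'r) (hQr.mul hS'r.closure)
    (BinRel.closure_mul_closure hQr hS'r).symm (τ * σ)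
  convert key using 1
  have e2 : ∀ U : BinRel X, R * (U * BinRel.ofPerm σ) =
      Q * (BinRel.ofPerm τ * U * BinRel.ofPerm τ⁻¹) * BinRel.ofPerm (τ * σ) := by
    intro U
    have e3 := congrArg (fun V => Q * V * BinRel.ofPerm σ) (e U)
    simp only [mul_assoc] at e3
    rw [hRQ, ← BinRel.ofPerm_mul]
    simpa only [mul_assoc] using e3
  rw [sub_mul, mul_sub, sub_mul]
  simp only [← map_mul]
  rw [hS', BinRel.closure_conj, e2, e2]

theorem nilSpan_mul_right (a : EssentialAlgebra k X) {x : EssentialAlgebra k X}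
    (hx : x ∈ nilSpan k X) : x * a ∈ nilSpan k X := by
  have h := Submodule.mul_mem_mul hx
    (show a ∈ Submodule.span k (Set.range (EssentialAlgebra.of k X)) by
      rw [essentialAlgebra_span]; trivial)
  rw [nilSpan, Submodule.span_mul_span] at h
  refine Submodule.span_le.2 ?_ h
  rintro _ ⟨_, ⟨S, σ, hS, -, rfl⟩, _, ⟨R, rfl⟩, rfl⟩
  show (EssentialAlgebra.of k X S - EssentialAlgebra.of k X S.closure) *
    EssentialAlgebra.of k X (BinRel.ofPerm σ) * EssentialAlgebra.of k X R ∈ nilSpan k X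
  by_cases hR : R.Inessential
  · rw [EssentialAlgebra.of_eq_zero k hR, mul_zero]
    exact zero_mem _
  obtain ⟨τ, hτ⟩ := BinRel.Essential.exists_perm hR
  -- `Δ_σ * R` contains `Δ_{σ τ}`, hence equals `Q * Δ_{σ τ}` with `Q` reflexive
  set Q : BinRel X := BinRel.ofPerm σ * R * BinRel.ofPerm (σ * τ)⁻¹ with hQ
  have hQr : Q.IsReflexive := fun x =>
    ⟨(σ * τ)⁻¹ x, ⟨σ⁻¹ x, by simp [BinRel.ofPerm], by simpa using hτ (τ⁻¹ (σ⁻¹ x))⟩, rfl⟩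
  have hRQ : BinRel.ofPerm σ * R = Q * BinRel.ofPerm (σ * τ) := by
    rw [hQ, mul_assoc _ (BinRel.ofPerm (σ * τ)⁻¹), BinRel.ofPerm_mul, inv_mul_cancel,
      BinRel.ofPerm_one, mul_one]
  have key := sub_mul_mem k (hS.mul hQr) (hS.closure.mul hQr)
    (BinRel.closure_closure_mul hQr hS).symm (σ * τ)
  convert key using 1
  rw [mul_assoc, ← map_mul, hRQ, sub_mul, sub_mul]
  simp only [← map_mul, mul_assoc]

/-- The `k`-submodule `N` as a two-sided ideal of the essential algebra. -/
noncomputable def nilIdeal : Ideal (EssentialAlgebra k X) where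
  carrier := nilSpan k X
  add_mem' := (nilSpan k X).add_mem'
  zero_mem' := (nilSpan k X).zero_mem'
  smul_mem' a _ hx := nilSpan_mul_left k X a hx

instance : (nilIdeal k X).IsTwoSided := ⟨fun a hx => nilSpan_mul_right k X a hx⟩

/-- The algebra of permuted orders `P = E / N` on the finite set `X`. -/
abbrev PermutedOrderAlgebra := EssentialAlgebra k X ⧸ nilIdeal k X

end EssentialAlgebra

/-! Modulo `nilIdeal`, the class of a reflexive relation depends only on its transitive closure. For
reflexive S and T, the products SS and S have the same closure, and so do ST and TS, so the classes
of reflexive relations are commuting idempotents, permuted by conjugation with the Δ_σ. An essential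
relation contains a permutation (`BinRel.Essential.exists_perm`), hence is Q Δ_τ with Q reflexive.
Thus the algebra is spanned by products of an idempotent and a group element, and a variant of
Maschke's theorem applies: a linear projection onto a left ideal is first made to commute with the
idempotents, then averaged over the group, whose order n! is invertible. -/

/-! ### A Maschke theorem for commuting idempotents permuted by a group -/

section IdempotentsAndGroup

variable {k : Type*} [Field k] {A : Type*} [Ring A] [Algebra k A]
  {M : Type*} [AddCommGroup M] [Module k M] [Module A M] [IsScalarTower k A M]

/-- A submodule is the image of a linear projection that commutes with the action of a given
finite set of commuting idempotents. -/
theorem exists_projection_commuting_idempotents (N : Submodule A M) (s : Finset A)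
    (hidem : ∀ e ∈ s, e * e = e) (hcomm : ∀ e ∈ s, ∀ f ∈ s, e * f = f * e) :
    ∃ π : M →ₗ[k] M, (∀ x, π x ∈ N) ∧ (∀ x ∈ N, π x = x) ∧
      ∀ e ∈ s, ∀ x, π (e • x) = e • π x := by
  classical
  induction s using Finset.induction_on with
  | empty =>
    obtain ⟨p, hp⟩ := (N.restrictScalars k).subtype.exists_leftInverse_of_injective
      (LinearMap.ker_eq_bot.2 Subtype.val_injective)
    refine ⟨(N.restrictScalars k).subtype ∘ₗ p, fun x => (p x).2, fun x hx => ?_, by simp⟩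
    exact congrArg Subtype.val (LinearMap.congr_fun hp ⟨x, hx⟩)
  | insert e s _ ih =>
    obtain ⟨π, hmem, hid, hs⟩ := ih (fun f hf => hidem f (Finset.mem_insert_of_mem hf))
      (fun f hf g hg => hcomm f (Finset.mem_insert_of_mem hf) g (Finset.mem_insert_of_mem hg))
    have he : e * e = e := hidem e (Finset.mem_insert_self _ _)
    have he' (y : M) : e • e • y = e • y := by rw [← mul_smul, he]
    let E : M →ₗ[k] M := Algebra.lsmul k k M e
    -- The block-diagonal part of π for the decomposition 1 = e + (1 - e). It commutes with e, and
    -- still with each earlier f because e and f commute.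
    refine ⟨E ∘ₗ π ∘ₗ E + (1 - E) ∘ₗ π ∘ₗ (1 - E), fun x => ?_, fun x hx => ?_, fun f hf x => ?_⟩
    · exact N.add_mem (N.smul_mem e (hmem _)) (N.sub_mem (hmem _) (N.smul_mem e (hmem _)))
    · simp [E, hid x hx, hid _ (N.smul_mem e hx), he', smul_sub]
    · rcases Finset.mem_insert.1 hf with rfl | hf
      · simp [E, he', smul_sub]
      · have hfe (y : M) : e • f • y = f • e • y := by
          rw [← mul_smul, ← mul_smul,
            hcomm e (Finset.mem_insert_self _ _) f (Finset.mem_insert_of_mem hf)]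
        simp [E, hfe, hs f hf, smul_sub]

/-- An algebra spanned by the products of a finite set of commuting idempotents with a finite group
of units that permutes this set by conjugation is semisimple if the order of the group is
invertible. -/
theorem isSemisimpleRing_of_span_idempotent_mul_group {G : Type*} [Group G] [Finite G]
    (u : G →* A) (s : Set A) (hfin : s.Finite) (hidem : ∀ e ∈ s, e * e = e)
    (hcomm : ∀ e ∈ s, ∀ f ∈ s, e * f = f * e)
    (hconj : ∀ g, ∀ e ∈ s, u g * e * u g⁻¹ ∈ s) (hcard : (Nat.card G : k) ≠ 0)
    (hspan : Submodule.span k {a | ∃ e ∈ s, ∃ g, a = e * u g} = ⊤) :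
    IsSemisimpleRing A := by
  classical
  have := Fintype.ofFinite G
  rw [Nat.card_eq_fintype_card] at hcard
  refine (isSemisimpleModule_iff A A).2 ⟨fun N => ?_⟩
  obtain ⟨π, hmem, hid, hs⟩ := exists_projection_commuting_idempotents (k := k) N hfin.toFinset
    (by simpa using hidem) (by simpa using hcomm)
  simp only [Set.Finite.mem_toFinset, smul_eq_mul] at hs
  have huu (g : G) : u g * u g⁻¹ = 1 := by rw [← map_mul, mul_inv_cancel, map_one]
  -- The Maschke average of the conjugates of π.
  let p : A →ₗ[k] A := (Fintype.card G : k)⁻¹ • ∑ g : G,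
    LinearMap.mulLeft k (u g) ∘ₗ π ∘ₗ LinearMap.mulLeft k (u g⁻¹)
  have hp (x : A) : p x = (Fintype.card G : k)⁻¹ • ∑ g : G, u g * π (u g⁻¹ * x) := by
    simp [p]
  have hpmem (x : A) : p x ∈ N := by
    rw [hp]
    exact N.smul_of_tower_mem _ (N.sum_mem fun g _ => N.smul_mem (u g) (hmem _))
  have hpid (x : A) (hx : x ∈ N) : p x = x := by
    have h (g : G) : u g * π (u g⁻¹ * x) = x := by
      rw [hid (u g⁻¹ * x) (N.smul_mem (u g⁻¹) hx), ← mul_assoc, huu, one_mul]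
    simp only [hp, h, Finset.sum_const, Finset.card_univ]
    rw [← Nat.cast_smul_eq_nsmul k, inv_smul_smul₀ hcard]
  -- Averaging keeps commutation with s: moving e past `u g⁻¹` turns it into a conjugate, which lies
  -- in s again and so commutes with π.
  have hpe (e : A) (he : e ∈ s) (x : A) : p (e * x) = e * p x := by
    rw [hp, hp, mul_smul_comm, Finset.mul_sum]
    congr 1
    refine Finset.sum_congr rfl fun g _ => ?_
    have h1 := hconj g⁻¹ e he
    rw [inv_inv] at h1
    have h2 : u g⁻¹ * (e * x) = u g⁻¹ * e * u g * (u g⁻¹ * x) := by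
      rw [mul_assoc _ (u g), ← mul_assoc (u g), huu, one_mul, mul_assoc]
    rw [h2, hs _ h1]
    simp only [← mul_assoc, huu, one_mul]
  have hpu (g : G) (x : A) : p (u g * x) = u g * p x := by
    rw [hp, hp, mul_smul_comm, Finset.mul_sum]
    congr 1
    refine Fintype.sum_equiv (Equiv.mulLeft g⁻¹) _ _ fun h => ?_
    simp only [Equiv.coe_mulLeft, map_mul, mul_inv_rev, inv_inv, mul_assoc]
    rw [← mul_assoc (u g), huu, one_mul]
  -- Commuting with the spanning products makes p linear over A, so its kernel is a left ideal
  -- complementing N.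
  have hpl (a x : A) : p (a * x) = a * p x := by
    have ha : a ∈ Submodule.span k {a | ∃ e ∈ s, ∃ g, a = e * u g} := hspan ▸ trivial
    induction ha using Submodule.span_induction with
    | mem a h =>
      obtain ⟨e, he, g, rfl⟩ := h
      rw [mul_assoc, hpe e he, hpu, mul_assoc]
    | zero => simp
    | add a b _ _ ha hb => rw [add_mul, map_add, ha, hb, add_mul]
    | smul c a _ ha => rw [smul_mul_assoc, map_smul, ha, smul_mul_assoc]
  let q : A →ₗ[A] N :=
    { toFun x := ⟨p x, hpmem x⟩
      map_add' x y := Subtype.ext (map_add p x y)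
      map_smul' a x := Subtype.ext (hpl a x) }
  exact ⟨LinearMap.ker q, LinearMap.isCompl_of_proj fun x => Subtype.ext (hpid x x.2)⟩

end IdempotentsAndGroup

/-! ### Reflexive relations as commuting idempotents -/

section PermutedOrders

namespace BinRel

variable {X : Type u}

instance [Finite X] : Finite (BinRel X) :=
  Finite.of_injective BinRel.rel fun _ _ h => BinRel.ext fun x y => by rw [h]

/-- The permutations of `X` as relations. -/
def ofPermHom (X : Type u) : Equiv.Perm X →* BinRel X where
  toFun := ofPerm
  map_one' := ofPerm_one
  map_mul' σ τ := (ofPerm_mul σ τ).symm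

/-- By reflexivity T * S contains both S and T, so its closure contains each two-step path of S * T.
-/
theorem closure_mul_le {S T : BinRel X} (hS : S.IsReflexive) (hT : T.IsReflexive) {x y : X}
    (h : (S * T).closure x y) : (T * S).closure x y := by
  refine closure_le ?_ x y h
  rintro a b ⟨c, hac, hcb⟩
  exact Relation.TransGen.trans (le_closure (⟨a, hT a, hac⟩ : (T * S) a c))
    (le_closure (⟨b, hcb, hS b⟩ : (T * S) c b))

theorem closure_mul_comm {S T : BinRel X} (hS : S.IsReflexive) (hT : T.IsReflexive) :
    (S * T).closure = (T * S).closure :=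
  ext fun _ _ => ⟨closure_mul_le hS hT, closure_mul_le hT hS⟩

theorem closure_mul_self {S : BinRel X} (hS : S.IsReflexive) : (S * S).closure = S.closure := by
  ext x y
  constructor
  · apply closure_le
    rintro a b ⟨c, hac, hcb⟩
    exact Relation.TransGen.trans (le_closure hac) (le_closure hcb)
  · exact closure_le (fun a b h => le_closure (⟨a, hS a, h⟩ : (S * S) a b)) x y

end BinRel

variable (k : Type v) [CommRing k] (X : Type u) [Finite X]

/-- The class of a relation in the algebra of permuted orders. -/
noncomputable def PermutedOrderAlgebra.of : BinRel X →* PermutedOrderAlgebra k X :=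
  (Ideal.Quotient.mk (nilIdeal k X) : EssentialAlgebra k X →* PermutedOrderAlgebra k X).comp
    (EssentialAlgebra.of k X)

variable {X} in
-- The difference of the two classes lies in `nilSpan`: this is `sub_mul_mem` for the trivial
-- permutation.
theorem PermutedOrderAlgebra.of_eq_of_closure_eq {S T : BinRel X} (hS : S.IsReflexive)
    (hT : T.IsReflexive) (h : S.closure = T.closure) : of k X S = of k X T := by
  refine Ideal.Quotient.eq.2 ?_
  have := sub_mul_mem k hS hT h 1
  rwa [BinRel.ofPerm_one, map_one, mul_one] at this

theorem permutedOrderAlgebra_span :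
    Submodule.span k (Set.range (PermutedOrderAlgebra.of k X)) = ⊤ := by
  have h := congrArg
    (Submodule.map (Ideal.Quotient.mkₐ k (nilIdeal k X)).toLinearMap) (essentialAlgebra_span k X)
  rw [Submodule.map_span, Submodule.map_top, LinearMap.range_eq_top.2
    (Ideal.Quotient.mkₐ_surjective k (nilIdeal k X)), ← Set.range_comp] at h
  exact h

end PermutedOrders

/-! ### Invertibility of n! and the main theorem -/

/-- A prime dividing n! is at most n. -/
theorem natCast_factorial_ne_zero_of_lt_ringChar (k : Type*) [Field k] (n : ℕ)
    (h : ringChar k = 0 ∨ n < ringChar k) : (n.factorial : k) ≠ 0 := by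
  rw [Ne, ringChar.spec]
  intro hdvd
  rcases h with h | h
  · rw [h, zero_dvd_iff] at hdvd
    exact n.factorial_ne_zero hdvd
  · rcases CharP.char_is_prime_or_zero k (ringChar k) with hp | hp
    · exact absurd (hp.dvd_factorial.1 hdvd) (not_le.2 h)
    · omega

theorem theorem8p4 (k : Type v) [Field k] (X : Type u) [Finite X]
    (hchar : ringChar k = 0 ∨ Nat.card X < ringChar k) :
    IsSemisimpleRing (PermutedOrderAlgebra k X) := by
  -- Inessential reflexive relations may stay in the family of idempotents, since their class is 0.
  refine isSemisimpleRing_of_span_idempotent_mul_group (k := k)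
    ((PermutedOrderAlgebra.of k X).comp (BinRel.ofPermHom X))
    (PermutedOrderAlgebra.of k X '' {S | S.IsReflexive}) (Set.toFinite _) ?_ ?_ ?_ ?_ ?_
  · rintro _ ⟨S, hS, rfl⟩
    rw [← map_mul]
    exact PermutedOrderAlgebra.of_eq_of_closure_eq k (hS.mul hS) hS (BinRel.closure_mul_self hS)
  · rintro _ ⟨S, hS, rfl⟩ _ ⟨T, hT, rfl⟩
    rw [← map_mul, ← map_mul]
    exact PermutedOrderAlgebra.of_eq_of_closure_eq k (hS.mul hT) (hT.mul hS)
      (BinRel.closure_mul_comm hS hT)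
  · rintro σ _ ⟨S, hS, rfl⟩
    exact ⟨BinRel.ofPerm σ * S * BinRel.ofPerm σ⁻¹, hS.conj σ, by
      rw [map_mul, map_mul]; rfl⟩
  · rw [Nat.card_perm]
    exact natCast_factorial_ne_zero_of_lt_ringChar k _ hchar
  · rw [eq_top_iff, ← permutedOrderAlgebra_span, Submodule.span_le]
    rintro _ ⟨R, rfl⟩
    by_cases hR : R.Inessential
    · have : PermutedOrderAlgebra.of k X R = 0 := by
        rw [PermutedOrderAlgebra.of, MonoidHom.comp_apply, EssentialAlgebra.of_eq_zero k hR]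
        exact map_zero (Ideal.Quotient.mk (nilIdeal k X))
      rw [this]
      exact zero_mem _
    -- As R contains Δ_τ, the relation R Δ_τ⁻¹ is reflexive.
    · obtain ⟨τ, hτ⟩ := BinRel.Essential.exists_perm hR
      refine Submodule.subset_span ⟨_, ⟨R * BinRel.ofPerm τ⁻¹, fun x =>
        ⟨τ⁻¹ x, by simpa using hτ (τ⁻¹ x), rfl⟩, rfl⟩, τ, ?_⟩
      change _ = PermutedOrderAlgebra.of k X _ * PermutedOrderAlgebra.of k X (BinRel.ofPerm τ)
      rw [← map_mul, mul_assoc, BinRel.ofPerm_mul, inv_mul_cancel, BinRel.ofPerm_one, mul_one]
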